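/- Let $G$ be a real reductive Lie group, let $K\subset G$ be a maximal compact subgroup and let $\Theta$ be the Cartan involution of $G$ attached to $K$. That is: $G$ is a finite-dimensional Hausdorff real Lie group whose Lie algebra $\mathfrak g$ is reductive (its radical is its centre); $K$ is a compact subgroup of $G$; $\Theta:G\to G$ is a smooth involutive automorphism with fixed-point group $G^{\Theta}=K$; writing $\theta=d\Theta(1)$ and $\mathfrak s=\{X\in\mathfrak g\mid \theta X=-X\}$, there is an $\mathrm{Ad}(G)$-invariant and $\theta$-invariant symmetric bilinear form $B$ on $\mathfrak g$ such that $-B(\cdot,\theta\,\cdot)$ is an inner product; and the map $K\times\mathfrak s\to G$, $(k,X)\mapsto k\exp X$, is a diffeomorphism. Let $\pi$ be an irreducible unitary representation of $G$, i.e. a strongly continuous homomorphism from $G$ to the unitary operators of a non-zero complex Hilbert space $\mathcal H_\pi$ whose only closed $G$-invariant subspaces are $\{0\}$ and $\mathcal H_\pi$. Then the space of $K$-invariants $$\mathcal H_\pi^K=\{v\in\mathcal H_\pi\mid \pi(k)v=v\ \text{for all } k\in K\}$$ is at most one-dimensional. -/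

import Mathlib

open scoped Manifold ContDiff

noncomputable section

/-! ### Lie groups: differentials, adjoint action, exponential map -/

section LieGroupBasics

variable {E : Type*} [NormedAddCommGroup E] [NormedSpace ℝ E]
  {G : Type*} [TopologicalSpace G] [ChartedSpace E G] [Group G]

/-- A real Lie group of class `C^∞` has the smoothness under which Mathlib puts the Lie bracket
on the tangent space at the identity. -/
instance lieGroup_minSmoothness_three [LieGroup 𝓘(ℝ, E) ∞ G] :
    LieGroup 𝓘(ℝ, E) (minSmoothness ℝ 3) G :=
  LieGroup.of_le (n := ∞) (by rw [minSmoothness_of_isRCLikeNormedField]; exact ENat.LEInfty.out)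

/-- The differential at the identity `dφ(1) : 𝔤 → 𝔤` of an endomorphism `φ` of a Lie group `G`
(the target `T_{φ(1)} G` is `𝔤 = T_1 G`, because `φ 1 = 1`). -/
def lieDifferential (φ : G →* G) :
    GroupLieAlgebra 𝓘(ℝ, E) G →L[ℝ] GroupLieAlgebra 𝓘(ℝ, E) G :=
  mfderiv 𝓘(ℝ, E) 𝓘(ℝ, E) φ (1 : G)

/-- The adjoint action `Ad(g) : 𝔤 → 𝔤`, the differential at `1` of `x ↦ g x g⁻¹`. -/
def lieAd (g : G) : GroupLieAlgebra 𝓘(ℝ, E) G →L[ℝ] GroupLieAlgebra 𝓘(ℝ, E) G :=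
  lieDifferential (MulAut.conj g).toMonoidHom

/-- `γ : ℝ → G` is a smooth one-parameter subgroup of `G` with initial velocity `γ'(0) = X`. -/
structure IsOneParameterSubgroup (γ : ℝ → G) (X : GroupLieAlgebra 𝓘(ℝ, E) G) : Prop where
  contMDiff : ContMDiff 𝓘(ℝ, ℝ) 𝓘(ℝ, E) ∞ γ
  map_add : ∀ s t : ℝ, γ (s + t) = γ s * γ t
  velocity : (mfderiv 𝓘(ℝ, ℝ) 𝓘(ℝ, E) γ (0 : ℝ) : ℝ →L[ℝ] E) (1 : ℝ) = X

open Classical in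
/-- The exponential map `exp : 𝔤 → G`: `exp X = γ(1)`, where `γ` is the one-parameter subgroup
with `γ'(0) = X`. (In a finite-dimensional Hausdorff Lie group there is exactly one such `γ`, so
that the last case does not occur.) -/
def lieExp (X : GroupLieAlgebra 𝓘(ℝ, E) G) : G :=
  if h : ∃ γ : ℝ → G, IsOneParameterSubgroup γ X then h.choose 1 else 1

/-- `IsRealReductive K Θ`: the Lie group `G` is a real reductive group, with maximal compact
subgroup `K` and with `Θ` the Cartan involution of `G` attached to `K`. Write `𝔤 = Lie(G)`,
`θ = dΘ(1)`, and `𝔰 = {X ∈ 𝔤 | θ X = -X}`. The requirements are the usual ones: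

* `𝔤` is a reductive Lie algebra, i.e. its radical is its centre;
* `K` is compact, and `Θ` is an involutive automorphism of the Lie group `G` with `G^Θ = K`
  (so that `Lie(K)` is the `+1`-eigenspace of `θ`);
* there is an `Ad(G)`-invariant and `θ`-invariant symmetric bilinear form `B` on `𝔤` such that
  `⟨X, Y⟩ = -B(X, θ Y)` is an inner product, i.e. `B` is negative definite on `Lie(K)` and positive
  definite on `𝔰`;
* the Cartan decomposition `K × 𝔰 → G`, `(k, X) ↦ k exp X`, is a diffeomorphism: it has a two-sided
  inverse `g ↦ (κ g, ξ g)` whose components are smooth. -/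
structure IsRealReductive [FiniteDimensional ℝ E] [LieGroup 𝓘(ℝ, E) ∞ G]
    (K : Subgroup G) (Θ : G ≃* G) : Prop where
  reductive :
    haveI : CompleteSpace E := FiniteDimensional.complete ℝ E
    LieAlgebra.HasCentralRadical ℝ (GroupLieAlgebra 𝓘(ℝ, E) G)
  isCompact : IsCompact (K : Set G)
  contMDiff : ContMDiff 𝓘(ℝ, E) 𝓘(ℝ, E) ∞ Θ
  involutive : ∀ g : G, Θ (Θ g) = g
  fixed_iff : ∀ g : G, Θ g = g ↔ g ∈ K
  exists_form : ∃ B : LinearMap.BilinForm ℝ (GroupLieAlgebra 𝓘(ℝ, E) G),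
    (∀ X Y, B X Y = B Y X) ∧
    (∀ g X Y, B (lieAd g X) (lieAd g Y) = B X Y) ∧
    (∀ X Y, B (lieDifferential Θ.toMonoidHom X) (lieDifferential Θ.toMonoidHom Y) = B X Y) ∧
    (∀ X, X ≠ 0 → 0 < -B X (lieDifferential Θ.toMonoidHom X))
  cartan_decomposition : ∃ (κ : G → G) (ξ : G → GroupLieAlgebra 𝓘(ℝ, E) G),
    ContMDiff 𝓘(ℝ, E) 𝓘(ℝ, E) ∞ κ ∧
    ContMDiff 𝓘(ℝ, E) 𝓘(ℝ, E) (M' := E) ∞ ξ ∧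
    (∀ g, κ g ∈ K ∧ lieDifferential Θ.toMonoidHom (ξ g) = -ξ g ∧ κ g * lieExp (ξ g) = g) ∧
    (∀ k ∈ K, ∀ X, lieDifferential Θ.toMonoidHom X = -X →
      κ (k * lieExp X) = k ∧ ξ (k * lieExp X) = X)

end LieGroupBasics

/-! ### Unitary representations -/

/-- A unitary representation of the topological group `G` on the Hilbert space `V`: a homomorphism
to the unitary operators on `V` that is strongly continuous. -/
structure UnitaryRep (G : Type*) [Group G] [TopologicalSpace G]
    (V : Type*) [NormedAddCommGroup V] [InnerProductSpace ℂ V] [CompleteSpace V] where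
  toMonoidHom : G →* unitary (V →L[ℂ] V)
  continuous_apply : ∀ v : V, Continuous fun g : G => (toMonoidHom g : V →L[ℂ] V) v

namespace UnitaryRep

variable {G : Type*} [Group G] [TopologicalSpace G]
  {V : Type*} [NormedAddCommGroup V] [InnerProductSpace ℂ V] [CompleteSpace V]

/-- The unitary operator `π(g)`. -/
def op (π : UnitaryRep G V) (g : G) : V →L[ℂ] V := (π.toMonoidHom g : V →L[ℂ] V)

/-- `π` is (topologically) irreducible: the Hilbert space is non-zero, and its only closed
`G`-invariant subspaces are `0` and the whole space. -/
def IsIrreducible (π : UnitaryRep G V) : Prop :=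
  Nontrivial V ∧ ∀ W : Submodule ℂ V, IsClosed (W : Set V) →
    (∀ g : G, ∀ v ∈ W, π.op g v ∈ W) → W = ⊥ ∨ W = ⊤

/-- The space `{v ∈ V | π(k) v = v for all k ∈ K}` of `K`-fixed vectors. -/
def fixedVectors (π : UnitaryRep G V) (K : Subgroup G) : Submodule ℂ V where
  carrier := {v | ∀ k ∈ K, π.op k v = v}
  add_mem' ha hb k hk := by rw [map_add, ha k hk, hb k hk]
  zero_mem' k _ := map_zero _
  smul_mem' c v hv k hk := by rw [map_smul, hv k hk]

end UnitaryRep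

end

/-! This is Gelfand's trick. Let P be the orthogonal projection onto the K-fixed vectors. Writing x
= k exp X, the Cartan involution gives Θ x = k exp(-X), so the anti-automorphism x ↦ (Θ x)⁻¹ sends x
to k⁻¹ x k⁻¹ and preserves every double coset KxK. Since P is the average of π over K, matrix
coefficients of P π(g) P π(h) P are integrals of K-bi-invariant functions over gKh, and the
anti-automorphism exchanges gKh with hKg up to K on both sides. Hence the compressions P π(g) P
commute (`commute_compression`). They form a self-adjoint family acting irreducibly on the image of
P (`IsIrreducible.compression`), so Schur's lemma (`rank_le_one_of_commute_of_irreducible`) finishes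
the proof. -/

/-! ### Schur's lemma via the continuous functional calculus. -/

/-- If a set `S` of operators acts irreducibly on a Hilbert space, a normal operator which commutes,
together with its adjoint, with every element of `S` is a scalar. -/
theorem exists_eq_algebraMap_of_commute_of_irreducible
    {H : Type*} [NormedAddCommGroup H] [InnerProductSpace ℂ H] [CompleteSpace H]
    {S : Set (H →L[ℂ] H)}
    (hirr : ∀ W : Submodule ℂ H, IsClosed (W : Set H) → (∀ b ∈ S, ∀ v ∈ W, b v ∈ W) →
      W = ⊥ ∨ W = ⊤)
    {a : H →L[ℂ] H} (ha : IsStarNormal a) (hcomm : ∀ b ∈ S, Commute a b)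
    (hcomm' : ∀ b ∈ S, Commute (star a) b) :
    ∃ c : ℂ, a = algebraMap ℂ (H →L[ℂ] H) c := by
  have hsub : (spectrum ℂ a).Subsingleton := by
    intro x hx y hy
    by_contra hxy
    -- Tent functions of radius r about two spectral points have product zero. Both give nonzero
    -- operators, so the kernel of the first is a closed invariant subspace that is neither zero nor
    -- everything.
    set r : ℝ := dist x y / 2 with hr
    have hr0 : 0 < r := half_pos (dist_pos.2 hxy)
    let f : ℂ → ℂ → ℂ := fun w z => ((max 0 (r - dist z w) : ℝ) : ℂ)
    have hf : ∀ w, Continuous (f w) := fun w => by fun_prop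
    have hne : ∀ w ∈ spectrum ℂ a, cfc (f w) a ≠ 0 := by
      intro w hw h0
      have hmem : f w w ∈ spectrum ℂ (cfc (f w) a) := by
        rw [cfc_map_spectrum (f w) a ha (hf w).continuousOn]
        exact ⟨w, hw, rfl⟩
      have hnt : Nontrivial (H →L[ℂ] H) := by
        by_contra hnt
        rw [not_nontrivial_iff_subsingleton] at hnt
        rw [spectrum.of_subsingleton] at hw
        exact hw
      rw [h0, spectrum.zero_eq, Set.mem_singleton_iff] at hmem
      simp only [f, dist_self, sub_zero, Complex.ofReal_eq_zero] at hmem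
      rw [max_eq_right hr0.le] at hmem
      exact hr0.ne' hmem
    have hmul : cfc (f x) a * cfc (f y) a = 0 := by
      rw [← cfc_mul (f x) (f y) a (hf x).continuousOn (hf y).continuousOn]
      have : (fun z => f x z * f y z) = fun _ => (0 : ℂ) := by
        funext z
        have htri : dist x y ≤ dist z x + dist z y := dist_triangle_left x y z
        rcases le_total r (dist z x) with h | h
        · simp [f, max_eq_left (sub_nonpos.2 h)]
        · have h' : r ≤ dist z y := by linarith
          simp [f, max_eq_left (sub_nonpos.2 h')]
      rw [this, cfc_const_zero]
    rcases hirr (LinearMap.ker (cfc (f x) a).toLinearMap)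
        (cfc (f x) a).isClosed_ker (fun b hb v hv => by
          have hcb : Commute (cfc (f x) a) b := (hcomm b hb).cfc (hcomm' b hb) (f x)
          have hv' : cfc (f x) a v = 0 := hv
          change cfc (f x) a (b v) = 0
          have := congrArg (fun T : H →L[ℂ] H => T v) hcb.eq
          simpa [hv'] using this) with h | h
    · refine hne y hy (ContinuousLinearMap.ext fun v => ?_)
      have hv : cfc (f y) a v ∈ LinearMap.ker (cfc (f x) a).toLinearMap :=
        congrArg (fun T : H →L[ℂ] H => T v) hmul
      rw [h] at hv
      exact hv
    · refine hne x hx (ContinuousLinearMap.ext fun v => ?_)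
      have hv : v ∈ LinearMap.ker (cfc (f x) a).toLinearMap := h ▸ Submodule.mem_top
      exact hv
  -- If the spectrum is empty, its inclusion in {0} holds trivially, so the scalar 0 serves.
  rcases hsub.eq_empty_or_singleton with h | ⟨c, h⟩
  · exact ⟨0, CFC.eq_algebraMap_of_spectrum_subset_singleton a 0 (by simp [h]) ha⟩
  · exact ⟨c, CFC.eq_algebraMap_of_spectrum_subset_singleton a c h.subset ha⟩

/-- **Schur's lemma** for a commutative self-adjoint family of operators: if it acts irreducibly on
a Hilbert space, the space is at most one-dimensional. -/
theorem rank_le_one_of_commute_of_irreducible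
    {H : Type*} [NormedAddCommGroup H] [InnerProductSpace ℂ H] [CompleteSpace H]
    {S : Set (H →L[ℂ] H)} (hstar : ∀ a ∈ S, star a ∈ S)
    (hcomm : ∀ a ∈ S, ∀ b ∈ S, Commute a b)
    (hirr : ∀ W : Submodule ℂ H, IsClosed (W : Set H) → (∀ a ∈ S, ∀ v ∈ W, a v ∈ W) →
      W = ⊥ ∨ W = ⊤) :
    Module.rank ℂ H ≤ 1 := by
  rw [rank_le_one_iff]
  rcases subsingleton_or_nontrivial H with hH | hH
  · exact ⟨0, fun v => ⟨0, Subsingleton.elim _ _⟩⟩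
  obtain ⟨v, hv⟩ := exists_ne (0 : H)
  have hspan : Submodule.span ℂ {v} = ⊤ := by
    refine (hirr (Submodule.span ℂ {v}) (Submodule.closed_of_finiteDimensional _)
      fun a ha w hw => ?_).resolve_left fun h => hv (Submodule.span_singleton_eq_bot.1 h)
    obtain ⟨c, hc⟩ := exists_eq_algebraMap_of_commute_of_irreducible hirr
      ⟨hcomm _ (hstar a ha) a ha⟩ (hcomm a ha) (hcomm _ (hstar a ha))
    rw [hc]
    exact Submodule.smul_mem _ c hw
  exact ⟨v, fun w => Submodule.mem_span_singleton.1 (hspan ▸ Submodule.mem_top)⟩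

/-! ### Compressions to the K-fixed vectors and Gelfand's trick. -/

section GelfandTrick

open MeasureTheory

/-- The Haar probability measure of a compact group is invariant under translations on both sides
and under inversion. -/
theorem integral_mul_inv_mul_eq_self {K : Type*} [Group K] [TopologicalSpace K]
    [IsTopologicalGroup K] [CompactSpace K] [MeasurableSpace K] [BorelSpace K] (μ : Measure K)
    [μ.IsHaarMeasure] [IsProbabilityMeasure μ] (f : K → ℂ) (b c : K) :
    ∫ k, f (b * k⁻¹ * c) ∂μ = ∫ k, f k ∂μ := by
  -- Right translates and the inverse of μ are again Haar probability measures, so uniqueness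
  -- identifies them with μ.
  have : μ.IsMulRightInvariant := ⟨fun k =>
    have := Measure.isProbabilityMeasure_map (μ := μ) (measurable_mul_const k).aemeasurable
    Measure.isHaarMeasure_eq_of_isProbabilityMeasure _ _⟩
  have : μ.IsInvInvariant := by
    have : IsProbabilityMeasure μ.inv :=
      Measure.isProbabilityMeasure_map measurable_inv.aemeasurable
    have : μ.inv.IsHaarMeasure := Measure.isHaarMeasure_of_isCompact_nonempty_interior _
      Set.univ isCompact_univ (by simp) (by simp) (by simp)
    exact ⟨Measure.isHaarMeasure_eq_of_isProbabilityMeasure _ _⟩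
  rw [integral_inv_eq_self (fun k => f (b * k * c)) μ,
    integral_mul_left_eq_self (fun k => f (k * c)) b, integral_mul_right_eq_self f c]

namespace UnitaryRep

variable {G : Type*} [Group G] [TopologicalSpace G]
  {V : Type*} [NormedAddCommGroup V] [InnerProductSpace ℂ V] [CompleteSpace V]

theorem op_one (π : UnitaryRep G V) (v : V) : π.op 1 v = v := by
  simp [op]

theorem op_mul (π : UnitaryRep G V) (g h : G) (v : V) : π.op (g * h) v = π.op g (π.op h v) := by
  simp [op]

theorem adjoint_op (π : UnitaryRep G V) (g : G) :
    ContinuousLinearMap.adjoint (π.op g) = π.op g⁻¹ := by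
  rw [op, op, map_inv, ← Unitary.star_eq_inv, Unitary.coe_star,
    ContinuousLinearMap.star_eq_adjoint]

theorem inner_op_right (π : UnitaryRep G V) (g : G) (u v : V) :
    inner ℂ u (π.op g v) = inner ℂ (π.op g⁻¹ u) v := by
  rw [← adjoint_op, ContinuousLinearMap.adjoint_inner_left]

theorem isClosed_fixedVectors (π : UnitaryRep G V) (K : Subgroup G) :
    IsClosed (π.fixedVectors K : Set V) := by
  have : (π.fixedVectors K : Set V) = ⋂ k ∈ K, {v | π.op k v = v} := by
    ext v
    simp [fixedVectors]
  rw [this]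
  exact isClosed_biInter fun k _ => isClosed_eq (π.op k).continuous continuous_id

instance completeSpace_fixedVectors (π : UnitaryRep G V) (K : Subgroup G) :
    CompleteSpace (π.fixedVectors K) :=
  (π.isClosed_fixedVectors K).completeSpace_coe

/-- The compression `P π(g) P` of `π(g)` to the space of `K`-fixed vectors. -/
noncomputable def compression (π : UnitaryRep G V) (K : Subgroup G) (g : G) :
    π.fixedVectors K →L[ℂ] π.fixedVectors K :=
  (π.fixedVectors K).orthogonalProjectionOnto ∘L π.op g ∘L (π.fixedVectors K).subtypeL

theorem inner_compression (π : UnitaryRep G V) (K : Subgroup G) (g : G)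
    (u w : π.fixedVectors K) :
    inner ℂ u (π.compression K g w) = inner ℂ (u : V) (π.op g w) := by
  simp [compression]

theorem star_compression (π : UnitaryRep G V) (K : Subgroup G) (g : G) :
    star (π.compression K g) = π.compression K g⁻¹ := by
  refine ContinuousLinearMap.ext fun w => ext_inner_left ℂ fun u => ?_
  rw [ContinuousLinearMap.star_eq_adjoint, ContinuousLinearMap.adjoint_inner_right,
    inner_compression, ← inner_conj_symm, inner_compression, inner_conj_symm, inner_op_right,
    inv_inv]

/-- The matrix coefficient of two `K`-fixed vectors is bi-invariant under `K`. -/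
theorem inner_op_mul_mul (π : UnitaryRep G V) {K : Subgroup G} {u w : V}
    (hu : u ∈ π.fixedVectors K) (hw : w ∈ π.fixedVectors K) {a b : G} (ha : a ∈ K) (hb : b ∈ K)
    (x : G) : inner ℂ u (π.op (a * x * b) w) = inner ℂ u (π.op x w) := by
  rw [op_mul, hw b hb, op_mul, inner_op_right, hu _ (K.inv_mem ha)]

theorem integrable_op (π : UnitaryRep G V) {K : Subgroup G} [CompactSpace K] [MeasurableSpace K]
    [BorelSpace K] (μ : Measure K) [μ.IsHaarMeasure] (v : V) :
    Integrable (fun k : K => π.op k v) μ :=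
  Continuous.integrable_of_hasCompactSupport
    ((π.continuous_apply v).comp continuous_subtype_val) (HasCompactSupport.of_compactSpace _)

section Average

variable [IsTopologicalGroup G] {K : Subgroup G} [CompactSpace K] [MeasurableSpace K]
  [BorelSpace K] (μ : Measure K) [μ.IsHaarMeasure] [IsProbabilityMeasure μ]

/-- Averaging over the compact group `K` is the orthogonal projection to the `K`-fixed vectors. -/
theorem starProjection_fixedVectors_eq_integral (π : UnitaryRep G V) (v : V) :
    (π.fixedVectors K).starProjection v = ∫ k : K, π.op k v ∂μ := by
  refine Submodule.eq_starProjection_of_mem_of_inner_eq_zero (fun h hh => ?_) fun w hw => ?_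
  · rw [← ContinuousLinearMap.integral_comp_comm _ (π.integrable_op μ v)]
    simp only [← op_mul]
    exact integral_mul_left_eq_self (μ := μ) (fun k : K => π.op k v) ⟨h, hh⟩
  · have hconst : ∫ k : K, inner ℂ w (π.op k v) ∂μ = inner ℂ w v := by
      have : ∀ k : K, inner ℂ w (π.op k v) = inner ℂ w v := fun k => by
        rw [inner_op_right, hw _ (K.inv_mem k.2)]
      simp [this]
    have hint : inner ℂ w (∫ k : K, π.op k v ∂μ) = inner ℂ w v :=
      (integral_inner (π.integrable_op μ v) w).symm.trans hconst
    rw [← inner_conj_symm, inner_sub_right, hint, sub_self, map_zero]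

/-- The projection between `π.op g` and `π.op h` is replaced by the average over K. -/
theorem inner_compression_comp (π : UnitaryRep G V) (g h : G) (u w : π.fixedVectors K) :
    inner ℂ u (π.compression K g (π.compression K h w)) =
      ∫ k : K, inner ℂ (u : V) (π.op (g * k * h) w) ∂μ := by
  have hP : ((π.compression K h w : π.fixedVectors K) : V) = ∫ k : K, π.op k (π.op h w) ∂μ := by
    rw [← starProjection_fixedVectors_eq_integral μ π]
    rfl
  rw [inner_compression, hP,
    ← ContinuousLinearMap.integral_comp_comm _ (π.integrable_op μ _),
    ← integral_inner ((π.op g).integrable_comp (π.integrable_op μ _))]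
  simp only [op_mul]

end Average

/-- **Gelfand's trick**: if an automorphism `Θ` fixes the compact subgroup `K` pointwise and
`(Θ x)⁻¹` lies in the double coset of `x`, the compressions of the operators of a unitary
representation to the `K`-fixed vectors commute. -/
theorem commute_compression [IsTopologicalGroup G] (π : UnitaryRep G V) {K : Subgroup G}
    (hK : IsCompact (K : Set G)) (Θ : G →* G) (hfix : ∀ k ∈ K, Θ k = k)
    (hdouble : ∀ x, ∃ a ∈ K, ∃ b ∈ K, (Θ x)⁻¹ = a * x * b) (g h : G) :
    Commute (π.compression K g) (π.compression K h) := by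
  have : CompactSpace K := isCompact_iff_compactSpace.1 hK
  let _ : MeasurableSpace K := borel K
  have : BorelSpace K := ⟨rfl⟩
  let μ : Measure K := Measure.haarMeasure ⊤
  have : IsProbabilityMeasure μ := ⟨Measure.haarMeasure_self⟩
  refine ContinuousLinearMap.ext fun w => ext_inner_left ℂ fun u => ?_
  change inner ℂ u (π.compression K g (π.compression K h w)) =
    inner ℂ u (π.compression K h (π.compression K g w))
  rw [inner_compression_comp μ, inner_compression_comp μ]
  obtain ⟨a, ha, b, hb, hab⟩ := hdouble h
  obtain ⟨c, hc, d, hd, hcd⟩ := hdouble g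
  -- Bi-invariance allows g k h to be replaced by (Θ (g k h))⁻¹ = a h (b k⁻¹ c) g d; the outer a and
  -- d are then absorbed.
  have key : ∀ k : K, inner ℂ (u : V) (π.op (g * k * h) w) =
      inner ℂ (u : V) (π.op (h * ((⟨b, hb⟩ * k⁻¹ * ⟨c, hc⟩ : K) : G) * g) w) := by
    intro k
    obtain ⟨p, hp, q, hq, hpq⟩ := hdouble (g * k * h)
    have hσ : (Θ (g * k * h))⁻¹ = a * (h * ((⟨b, hb⟩ * k⁻¹ * ⟨c, hc⟩ : K) : G) * g) * d := by
      rw [map_mul, map_mul, mul_inv_rev, mul_inv_rev, hab, hcd, hfix _ k.2]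
      simp [mul_assoc]
    rw [← inner_op_mul_mul π u.2 w.2 hp hq, ← hpq, hσ, inner_op_mul_mul π u.2 w.2 ha hd]
  let f : K → ℂ := fun k => inner ℂ (u : V) (π.op (h * (k : G) * g) w)
  simp only [key]
  exact integral_mul_inv_mul_eq_self μ f ⟨b, hb⟩ ⟨c, hc⟩

/-- The compressions of the operators of an irreducible representation act irreducibly on the
`K`-fixed vectors. -/
theorem IsIrreducible.compression {π : UnitaryRep G V} (hπ : π.IsIrreducible) (K : Subgroup G)
    (W : Submodule ℂ (π.fixedVectors K)) (hW : IsClosed (W : Set (π.fixedVectors K)))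
    (hinv : ∀ g, ∀ w ∈ W, π.compression K g w ∈ W) : W = ⊥ ∨ W = ⊤ := by
  let U : Submodule ℂ V := Submodule.span ℂ {v | ∃ g, ∃ w ∈ W, π.op g w = v}
  have hUop : ∀ g, ∀ v ∈ U, π.op g v ∈ U := by
    intro g v hv
    induction hv using Submodule.span_induction with
    | mem v hv =>
      obtain ⟨x, w, hw, rfl⟩ := hv
      exact Submodule.subset_span ⟨g * x, w, hw, π.op_mul g x w⟩
    | zero => simp
    | add x y _ _ hx hy => rw [map_add]; exact U.add_mem hx hy
    | smul c x _ hx => rw [map_smul]; exact U.smul_mem c hx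
  -- Projecting π(g) w gives the compression applied to w, which stays in W. So if U is dense, every
  -- fixed vector, being its own projection, lies in W.
  have hUW : U ≤ W.comap ((π.fixedVectors K).orthogonalProjectionOnto : V →ₗ[ℂ] _) := by
    refine Submodule.span_le.2 ?_
    rintro _ ⟨g, w, hw, rfl⟩
    exact hinv g w hw
  have hclosed : IsClosed
      (W.comap ((π.fixedVectors K).orthogonalProjectionOnto : V →ₗ[ℂ] _) : Set V) :=
    hW.preimage (π.fixedVectors K).orthogonalProjectionOnto.continuous
  rcases hπ.2 U.topologicalClosure U.isClosed_topologicalClosure (fun g v hv =>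
    map_mem_closure (π.op g).continuous hv (hUop g)) with h | h
  · left
    refine (Submodule.eq_bot_iff _).2 fun w hw => ?_
    have hmem : (w : V) ∈ U.topologicalClosure :=
      U.le_topologicalClosure (Submodule.subset_span ⟨1, w, hw, π.op_one w⟩)
    rw [h, Submodule.mem_bot] at hmem
    exact Subtype.ext hmem
  · right
    refine (Submodule.eq_top_iff').2 fun w => ?_
    have hmem : (w : V) ∈ U.topologicalClosure := h ▸ Submodule.mem_top
    have := U.topologicalClosure_minimal hUW hclosed hmem
    simpa using this

end UnitaryRep

end GelfandTrick

/-! ### One-parameter subgroups and the exponential map. -/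

section LieGroupExp

variable {E : Type*} [NormedAddCommGroup E] [NormedSpace ℝ E]
  {G : Type*} [TopologicalSpace G] [ChartedSpace E G] [Group G]

theorem IsOneParameterSubgroup.map_zero {γ : ℝ → G} {X : GroupLieAlgebra 𝓘(ℝ, E) G}
    (h : IsOneParameterSubgroup γ X) : γ 0 = 1 := by
  simpa using h.map_add 0 0

theorem IsOneParameterSubgroup.mdifferentiable {γ : ℝ → G} {X : GroupLieAlgebra 𝓘(ℝ, E) G}
    (h : IsOneParameterSubgroup γ X) : MDifferentiable 𝓘(ℝ, ℝ) 𝓘(ℝ, E) γ :=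
  h.contMDiff.mdifferentiable (by simp)

theorem IsOneParameterSubgroup.hasMFDerivAt_zero {γ : ℝ → G} {X : GroupLieAlgebra 𝓘(ℝ, E) G}
    (h : IsOneParameterSubgroup γ X) :
    HasMFDerivAt 𝓘(ℝ, ℝ) 𝓘(ℝ, E) γ 0
      ((1 : ℝ →L[ℝ] ℝ).smulRight (X : E) : ℝ →L[ℝ] E) := by
  refine (h.mdifferentiable 0).hasMFDerivAt.congr_mfderiv ?_
  refine ContinuousLinearMap.ext_ring (R₁ := ℝ) (M₁ := E) (h.velocity.trans ?_)
  exact (one_smul ℝ (X : E)).symm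

/-- Differentiating γ(s) = γ(t) γ(s - t) at s = t gives the left translate of X by γ(t). Uniqueness
of integral curves then applies to one-parameter subgroups. -/
theorem IsOneParameterSubgroup.isMIntegralCurve [LieGroup 𝓘(ℝ, E) ∞ G]
    {γ : ℝ → G} {X : GroupLieAlgebra 𝓘(ℝ, E) G} (h : IsOneParameterSubgroup γ X) :
    IsMIntegralCurve (I := 𝓘(ℝ, E)) γ (mulInvariantVectorField X) := by
  intro t
  have hγ : γ = (fun x => γ t * x) ∘ γ ∘ fun s => s - t := by
    funext s
    simp [← h.map_add]
  have hsub : HasMFDerivAt 𝓘(ℝ, ℝ) 𝓘(ℝ, ℝ) (fun s : ℝ => s - t) t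
      (ContinuousLinearMap.id ℝ ℝ) :=
    ((hasFDerivAt_id t).sub_const t).hasMFDerivAt
  have h0 : HasMFDerivAt 𝓘(ℝ, ℝ) 𝓘(ℝ, E) γ (t - t)
      ((1 : ℝ →L[ℝ] ℝ).smulRight (X : E) : ℝ →L[ℝ] E) := by
    rw [sub_self]
    exact h.hasMFDerivAt_zero
  have hmul : HasMFDerivAt 𝓘(ℝ, E) 𝓘(ℝ, E) (fun x => γ t * x) (1 : G)
      (mfderiv 𝓘(ℝ, E) 𝓘(ℝ, E) (fun x => γ t * x) (1 : G)) :=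
    ((contMDiff_mul_left (I := 𝓘(ℝ, E)) (n := ∞) (a := γ t)).mdifferentiable
      (by simp) 1).hasMFDerivAt
  have h1 : HasMFDerivAt 𝓘(ℝ, ℝ) 𝓘(ℝ, E) (γ ∘ fun s => s - t) t
      (((1 : ℝ →L[ℝ] ℝ).smulRight (X : E) : ℝ →L[ℝ] E).comp (ContinuousLinearMap.id ℝ ℝ)) :=
    HasMFDerivAt.comp t h0 hsub
  have hpt : (γ ∘ fun s => s - t) t = 1 := by simp [h.map_zero]
  have h2 := HasMFDerivAt.comp (g := fun x => γ t * x) t (by rw [hpt]; exact hmul) h1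
  rw [← hγ] at h2
  refine h2.congr_mfderiv (ContinuousLinearMap.ext_ring (R₁ := ℝ) (M₁ := E) ?_)
  change (mfderiv 𝓘(ℝ, E) 𝓘(ℝ, E) (fun x => γ t * x) (1 : G)) ((1 : ℝ) • (X : E)) =
    (1 : ℝ) • mfderiv 𝓘(ℝ, E) 𝓘(ℝ, E) (fun x => γ t * x) (1 : G) X
  exact map_smul _ _ _

/-- A one-parameter subgroup of a Hausdorff Lie group is determined by its initial velocity. -/
theorem IsOneParameterSubgroup.unique [CompleteSpace E] [T2Space G] [LieGroup 𝓘(ℝ, E) ∞ G]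
    {γ γ' : ℝ → G} {X : GroupLieAlgebra 𝓘(ℝ, E) G} (h : IsOneParameterSubgroup γ X)
    (h' : IsOneParameterSubgroup γ' X) : γ = γ' := by
  have : IsManifold 𝓘(ℝ, E) 1 G := IsManifold.of_le (n := ∞) (by simp)
  refine isMIntegralCurve_Ioo_eq_of_contMDiff_boundaryless (I := 𝓘(ℝ, E)) (t₀ := 0)
    (v := mulInvariantVectorField X)
    ((contMDiff_mulInvariantVectorField X).of_le ?_) h.isMIntegralCurve h'.isMIntegralCurve
    (h.map_zero.trans h'.map_zero.symm)
  rw [minSmoothness_of_isRCLikeNormedField]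
  norm_num

theorem IsOneParameterSubgroup.comp_neg {γ : ℝ → G} {X : GroupLieAlgebra 𝓘(ℝ, E) G}
    (h : IsOneParameterSubgroup γ X) : IsOneParameterSubgroup (fun t => γ (-t)) (-X) where
  contMDiff := h.contMDiff.comp (contDiff_neg.contMDiff)
  map_add s t := by rw [neg_add, h.map_add]
  velocity := by
    have hneg : HasMFDerivAt 𝓘(ℝ, ℝ) 𝓘(ℝ, ℝ) (fun s : ℝ => -s) 0
        (-ContinuousLinearMap.id ℝ ℝ) := (hasFDerivAt_id (0 : ℝ)).neg.hasMFDerivAt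
    have h0 : HasMFDerivAt 𝓘(ℝ, ℝ) 𝓘(ℝ, E) γ (-0)
        ((1 : ℝ →L[ℝ] ℝ).smulRight (X : E) : ℝ →L[ℝ] E) := by
      rw [neg_zero]
      exact h.hasMFDerivAt_zero
    have e := (HasMFDerivAt.comp (g := γ) 0 h0 hneg).mfderiv
    refine (congrArg (fun T : ℝ →L[ℝ] E => T 1) e).trans ?_
    change (-1 : ℝ) • (X : E) = -X
    exact neg_one_smul ℝ (X : E)

theorem IsOneParameterSubgroup.map_hom {γ : ℝ → G} {X : GroupLieAlgebra 𝓘(ℝ, E) G}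
    (h : IsOneParameterSubgroup γ X) (φ : G →* G) (hφ : ContMDiff 𝓘(ℝ, E) 𝓘(ℝ, E) ∞ φ) :
    IsOneParameterSubgroup (fun t => φ (γ t)) (lieDifferential φ X) where
  contMDiff := hφ.comp h.contMDiff
  map_add s t := by rw [h.map_add, _root_.map_mul]
  velocity := by
    have hd : HasMFDerivAt 𝓘(ℝ, E) 𝓘(ℝ, E) φ (1 : G) (mfderiv 𝓘(ℝ, E) 𝓘(ℝ, E) φ (1 : G)) :=
      (hφ.mdifferentiable (by simp) 1).hasMFDerivAt
    have e := (HasMFDerivAt.comp (g := φ) 0 (by rw [h.map_zero]; exact hd)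
      h.hasMFDerivAt_zero).mfderiv
    refine (congrArg (fun T : ℝ →L[ℝ] E => T 1) e).trans ?_
    change mfderiv 𝓘(ℝ, E) 𝓘(ℝ, E) φ (1 : G) ((1 : ℝ) • (X : E)) =
      mfderiv 𝓘(ℝ, E) 𝓘(ℝ, E) φ (1 : G) X
    exact congrArg _ (one_smul ℝ (X : E))

/-- An endomorphism of a Lie group whose differential maps `X` to `-X` inverts `exp X`. -/
theorem map_lieExp_eq_inv [CompleteSpace E] [T2Space G] [LieGroup 𝓘(ℝ, E) ∞ G]
    (φ : G →* G) (hφ : ContMDiff 𝓘(ℝ, E) 𝓘(ℝ, E) ∞ φ) {X : GroupLieAlgebra 𝓘(ℝ, E) G}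
    (hX : lieDifferential φ X = -X) : φ (lieExp X) = (lieExp X)⁻¹ := by
  unfold lieExp
  split_ifs with h
  · have hγ := h.choose_spec
    have h1 := hγ.map_hom φ hφ
    rw [hX] at h1
    -- Both φ ∘ γ and t ↦ γ(-t) have initial velocity -X, so they coincide.
    have h2 : φ (h.choose 1) = h.choose (-1) := congrFun (h1.unique hγ.comp_neg) 1
    rw [h2, eq_inv_iff_mul_eq_one, ← hγ.map_add, neg_add_cancel, hγ.map_zero]
  -- Here `lieExp X` takes its default value 1.
  · simp

end LieGroupExp

theorem theorem3p1
    {E : Type*} [NormedAddCommGroup E] [NormedSpace ℝ E] [FiniteDimensional ℝ E]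
    {G : Type*} [TopologicalSpace G] [T2Space G] [ChartedSpace E G] [Group G]
    [LieGroup 𝓘(ℝ, E) ∞ G]
    (K : Subgroup G) (Θ : G ≃* G) (hG : IsRealReductive (E := E) K Θ)
    {V : Type*} [NormedAddCommGroup V] [InnerProductSpace ℂ V] [CompleteSpace V]
    (π : UnitaryRep G V) (hπ : π.IsIrreducible) :
    Module.rank ℂ (π.fixedVectors K) ≤ 1 := by
  have : CompleteSpace E := FiniteDimensional.complete ℝ E
  have : IsTopologicalGroup G := topologicalGroup_of_lieGroup 𝓘(ℝ, E) ∞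
  have hfix : ∀ k ∈ K, Θ k = k := fun k hk => (hG.fixed_iff k).2 hk
  have hdouble : ∀ x, ∃ a ∈ K, ∃ b ∈ K, (Θ x)⁻¹ = a * x * b := by
    obtain ⟨κ, ξ, -, -, hcartan, -⟩ := hG.cartan_decomposition
    intro x
    obtain ⟨hκ, hξ, hx⟩ := hcartan x
    -- With k = κ x, (k exp(-X))⁻¹ = exp X · k⁻¹ = k⁻¹ x k⁻¹.
    refine ⟨(κ x)⁻¹, K.inv_mem hκ, (κ x)⁻¹, K.inv_mem hκ, ?_⟩
    have hexp : Θ (lieExp (ξ x)) = (lieExp (ξ x))⁻¹ :=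
      map_lieExp_eq_inv Θ.toMonoidHom hG.contMDiff hξ
    have hΘ : Θ x = κ x * (lieExp (ξ x))⁻¹ := by
      conv_lhs => rw [← hx]
      rw [map_mul, hfix _ hκ, hexp]
    have hexp' : lieExp (ξ x) = (κ x)⁻¹ * x := eq_inv_mul_of_mul_eq hx
    rw [hΘ, mul_inv_rev, inv_inv, hexp']
  refine rank_le_one_of_commute_of_irreducible (S := Set.range (π.compression K)) ?_ ?_
    fun W hW hinv => hπ.compression K W hW fun g => hinv _ ⟨g, rfl⟩
  · rintro _ ⟨g, rfl⟩
    exact ⟨g⁻¹, (π.star_compression K g).symm⟩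
  · rintro _ ⟨g, rfl⟩ _ ⟨h, rfl⟩
    exact π.commute_compression hG.isCompact Θ.toMonoidHom hfix hdouble g h
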